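/- **Theorem.** For $a,b>-1$ let $P_n^{(a,b)}$ denote the Jacobi polynomials in the standard normalization, $$P_n^{(a,b)}(x)=\frac1{n!}\sum_{j=0}^{n}\binom nj (n+a+b+1)_j\,(a+j+1)_{n-j}\Big(\frac{x-1}2\Big)^j ,$$ and let $\omega_{\alpha,\gamma}(x)=(1-x)^{\alpha}(1+x)^{\gamma}$. Let $\alpha,\gamma,\beta\in\mathbb R$ with $\alpha,\gamma>-1$, put $\Lambda=\alpha\beta$, $\Delta=\gamma\beta$, and assume $\Lambda,\Delta>-1$. For integers $m,n,s\ge 0$ the integral $$\mathcal J_{m,n}(s,\alpha,\gamma,\beta)=\int_{-1}^{1}x^{s}[\omega_{\alpha,\gamma}(x)]^{\beta}P_m^{(\alpha,\gamma)}(x)P_n^{(\alpha,\gamma)}(x)\,dx$$ exists and $$\mathcal J_{m,n}(s,\alpha,\gamma,\beta)=\sum_{k=0}^{n}\sum_{j=0}^{m}\sum_{i=0}^{k+s}A_{n,k}\,A_{m,j}\,c_{ksi}\,h_j\,\delta_{i,j},\qquad h_j=\frac{2^{\Lambda+\Delta+1}\Gamma(\Lambda+j+1)\Gamma(\Delta+j+1)}{j!\,(\Lambda+\Delta+2j+1)\Gamma(\Lambda+\Delta+j+1)},$$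 where, for $0\le k\le i$, $$A_{i,k}=\frac{(-1)^{i-k}(\Delta+2k+\Lambda+1)\Gamma(i+\gamma+1)\Gamma(i+\Lambda+1)\Gamma(k+\Delta+\Lambda+1)\Gamma(i+k+\alpha+\gamma+1)}{(i-k)!\,\Gamma(k+\gamma+1)\Gamma(k+\Lambda+1)\Gamma(i+\alpha+\gamma+1)\Gamma(i+k+\Delta+\Lambda+2)}\;{}_3F_2(k-i,-\alpha-i,\Delta+k+1;-i-\Lambda,\gamma+k+1;1)$$ and, for $0\le i\le k+s$, $$c_{ksi}=\frac{(-1)^{k+s-i}2^{i}s!\,(2i+\Lambda+\Delta+1)\Gamma(i+\Lambda+\Delta+1)\Gamma(k+\Lambda+1)\Gamma(k+\Delta+1)}{\Gamma(i+\Lambda+1)\Gamma(i+\Delta+1)\Gamma(k+\Lambda+\Delta+1)}\sum_{r=\max(0,i-s)}^{\min(i,k)}\binom ir\frac{\Gamma(k+r+\Lambda+\Delta+1)}{2^{r}(s-i+r)!\,\Gamma(2i+k-r+\Lambda+\Delta+2)}$$ $$\qquad\times\sum_{l=0}^{k-r}\frac{(-1)^{l}\Gamma(i+k-r+\Lambda-l+1)\Gamma(i+\Delta+l+1)}{l!\,(k-r-l)!\,\Gamma(k+\Lambda-l+1)\Gamma(r+\Delta+l+1)}\;{}_2F_1(i-s-r,\,i+\Delta+l+1;\,2i+k-r+\Lambda+\Delta+2;\,2).$$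 Both hypergeometric series terminate. Moreover $A_{i,k}$, $c_{ksi}$ and $h_j$ are the connection coefficients, the expansion coefficients and the norms in $$P_i^{(\alpha,\gamma)}=\sum_{k=0}^{i}A_{i,k}P_k^{(\Lambda,\Delta)},\qquad x^{s}P_k^{(\Lambda,\Delta)}(x)=\sum_{i=0}^{k+s}c_{ksi}P_i^{(\Lambda,\Delta)}(x),\qquad \int_{-1}^{1}P_i^{(\Lambda,\Delta)}P_j^{(\Lambda,\Delta)}\,\omega_{\Lambda,\Delta}\,dx=h_j\,\delta_{i,j}.$$ When $\alpha+\gamma=-1$ or $\Lambda+\Delta=-1$, expressions with a removable singularity are read by continuity: $(2i+t)\Gamma(i+t)$ with $t=\Lambda+\Delta+1$ is $\Gamma(t+1)$ for $i=0$, and $\Gamma(x+r)/\Gamma(x)$ is the Pochhammer symbol $(x)_r$. -/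

import Mathlib

noncomputable section

namespace KreinJacobi

open Polynomial

/-- Rising factorial `(x)_k = x (x + 1) ⋯ (x + k - 1)`. -/
def rising (x : ℝ) (k : ℕ) : ℝ := (ascPochhammer ℝ k).eval x

/-- `(x)_k = Γ(x + k) / Γ(x)` away from the poles of `Γ`. At a pole, `(x)_k` is the limit of
the quotient, and it is used below in place of `Γ(x + k) / Γ(x)`. -/
theorem rising_eq_Gamma_div (x : ℝ) (k : ℕ) (hx : ∀ m : ℕ, x ≠ -m) :
    rising x k = Real.Gamma (x + k) / Real.Gamma x := by
  have h0 : Real.Gamma x ≠ 0 := Real.Gamma_ne_zero hx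
  rw [eq_div_iff h0]
  induction k with
  | zero => simp [rising]
  | succ k ih =>
    have hk : x + k ≠ 0 := fun h => hx k (by linarith)
    have h1 : rising x (k + 1) = rising x k * (x + k) := by
      simp [rising, ascPochhammer_succ_eval]
    have h2 : x + ((k + 1 : ℕ) : ℝ) = (x + k) + 1 := by push_cast; ring
    rw [h1, h2, Real.Gamma_add_one hk, ← ih]
    ring

/-- `(t + 2 j) Γ(t + j)`, with the removable singularity at `j = 0`, `t = 0` filled in:
for `j = 0` the product is `t Γ(t) = Γ(t + 1)`. -/
def gammaFactor (t : ℝ) (j : ℕ) : ℝ :=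
  if j = 0 then Real.Gamma (t + 1) else (t + 2 * j) * Real.Gamma (t + j)

theorem gammaFactor_eq (t : ℝ) (j : ℕ) (ht : t ≠ 0) :
    gammaFactor t j = (t + 2 * j) * Real.Gamma (t + j) := by
  unfold gammaFactor
  split_ifs with h
  · subst h
    simp [Real.Gamma_add_one ht]
  · rfl

/-- The Jacobi polynomial
`P_n^{(a,b)}(x) = (1 / n!) ∑_j (n choose j) (n + a + b + 1)_j (a + j + 1)_{n - j} ((x - 1) / 2)^j`
(standard normalization, `P_n^{(a,b)}(1) = (a + 1)_n / n!`). -/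
def jacobi (a b : ℝ) (n : ℕ) : ℝ[X] :=
  ∑ j ∈ Finset.range (n + 1),
    C (((n.factorial : ℝ))⁻¹ * (n.choose j : ℝ) * rising (n + a + b + 1) j
        * rising (a + j + 1) (n - j)) * (C (1 / 2 : ℝ) * (X - 1)) ^ j

/-- The Jacobi weight `(1 - x)^a (1 + x)^b`. -/
def jacobiWeight (a b x : ℝ) : ℝ := (1 - x) ^ a * (1 + x) ^ b

/-- The integrand `x^s [ω_{α,γ}(x)]^β P_m^{(α,γ)}(x) P_n^{(α,γ)}(x)`. -/
def kreinIntegrand (m n s : ℕ) (α γ β x : ℝ) : ℝ :=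
  x ^ s * (jacobiWeight α γ x) ^ β * (jacobi α γ m).eval x * (jacobi α γ n).eval x

/-- The Krein-like 2-functional of the Jacobi polynomials. -/
def kreinFunctional (m n s : ℕ) (α γ β : ℝ) : ℝ :=
  ∫ x in Set.Ioo (-1 : ℝ) 1, kreinIntegrand m n s α γ β x

/-- The generalized hypergeometric series `₃F₂(a₁, a₂, a₃; b₁, b₂; x)`. -/
def hyp32 (a₁ a₂ a₃ b₁ b₂ x : ℝ) : ℝ :=
  ∑' t : ℕ, rising a₁ t * rising a₂ t * rising a₃ t
    / (rising b₁ t * rising b₂ t * (t.factorial : ℝ)) * x ^ t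

/-- The connection coefficient of `P_k^{(L,D)}` in `P_i^{(α,γ)}`, for `k ≤ i`:
`(-1)^{i-k} (D+2k+L+1) Γ(i+γ+1) Γ(i+L+1) Γ(k+D+L+1) Γ(i+k+α+γ+1)` over
`(i-k)! Γ(k+γ+1) Γ(k+L+1) Γ(i+α+γ+1) Γ(i+k+D+L+2)`,
times `₃F₂(k-i, -α-i, D+k+1; -i-L, γ+k+1; 1)`. -/
def connCoeff (α γ L D : ℝ) (i k : ℕ) : ℝ :=
  (-1) ^ (i - k)
    * (gammaFactor (L + D + 1) k * Real.Gamma (i + γ + 1) * Real.Gamma (i + L + 1)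
        * rising (i + α + γ + 1) k)
    / (((i - k).factorial : ℝ) * Real.Gamma (k + γ + 1) * Real.Gamma (k + L + 1)
        * Real.Gamma (i + k + D + L + 2))
    * hyp32 (k - i) (-α - i) (D + k + 1) (-i - L) (γ + k + 1) 1

/-- The coefficient of `P_i^{(L,D)}` in `x^s P_k^{(L,D)}`, for `i ≤ k + s`. The quotient
`Γ(k+r+L+D+1) / Γ(k+L+D+1)` is `rising (k + L + D + 1) r`, the product
`(2i+L+D+1) Γ(i+L+D+1)` is `gammaFactor (L + D + 1) i`, and the lower limit `i - s` is the
truncated difference `max(0, i - s)`. -/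
def linCoeff (L D : ℝ) (k s i : ℕ) : ℝ :=
  (-1) ^ (k + s - i) * 2 ^ i * (s.factorial : ℝ)
    * (gammaFactor (L + D + 1) i * Real.Gamma (k + L + 1) * Real.Gamma (k + D + 1))
    / (Real.Gamma (i + L + 1) * Real.Gamma (i + D + 1))
    * ∑ r ∈ Finset.Icc (i - s) (min i k),
        (i.choose r : ℝ) * rising (k + L + D + 1) r
          / (2 ^ r * ((s + r - i).factorial : ℝ) * Real.Gamma (2 * i + k - r + L + D + 2))
          * ∑ l ∈ Finset.range (k - r + 1),
              (-1) ^ l * Real.Gamma (i + k - r + L - l + 1) * Real.Gamma (i + D + l + 1)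
                / ((l.factorial : ℝ) * ((k - r - l).factorial : ℝ)
                    * Real.Gamma (k + L - l + 1) * Real.Gamma (r + D + l + 1))
                * ordinaryHypergeometric ((i : ℝ) - s - r) (i + D + l + 1)
                    (2 * i + k - r + L + D + 2) (2 : ℝ)

/-- The Jacobi norm
`2^{L+D+1} Γ(L+j+1) Γ(D+j+1) / (j! (L+D+2j+1) Γ(L+D+j+1))`. -/
def jacobiNorm (L D : ℝ) (j : ℕ) : ℝ :=
  2 ^ (L + D + 1) * Real.Gamma (L + j + 1) * Real.Gamma (D + j + 1)
    / ((j.factorial : ℝ) * gammaFactor (L + D + 1) j)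

end KreinJacobi

end

open Polynomial MeasureTheory

namespace KreinJacobi

/-! ### The beta integral on `(-1, 1)` -/

/-! On (-1, 1) the power ω_{α,γ}^β is again a Jacobi weight ω_{Λ,Δ}. Expanding P_m and P_n in the
polynomials P^{(Λ,Δ)} orthogonal for that weight, and then each x^s P_k^{(Λ,Δ)} in the same basis,
reduces the integral to the triple sum by orthogonality. What has to be computed is the
coefficients.

They all follow from one identity, `jacobiFunctional_mul_jacobi`: ∫ Q P_i ω_{a,b} = (2^i i!)⁻¹ ∫
Q^{(i)} ω_{a+i,b+i}. No boundary terms are needed: by linearity Q = ((x+1)/2)^p suffices. There the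
expansion `jacobi_eq_sum_choose` turns the left side into a sum of beta integrals, which is an i-th
forward difference of a rising factorial, while the right side is a single beta integral or zero.

Taking deg Q < i gives orthogonality and Q = P_i the norm. For Q = P_n^{(α,γ)}, differentiation only
shifts the parameters, and the remaining sum of beta integrals is the ₃F₂ at 1. For Q = x^s P_k the
Leibniz rule leaves integrals of x^q P_{k-r}, which produce the ₂F₁ at 2. Since P_i has exact degree
i, these inner products determine the expansions (`eq_sum_jacobi_of_forall`). -/

theorem intervalIntegrable_beta {u v : ℝ} (hu : 0 < u) (hv : 0 < v) :
    IntervalIntegrable (fun x : ℝ => x ^ (u - 1) * (1 - x) ^ (v - 1)) volume 0 1 := by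
  have h := Complex.betaIntegral_convergent (u := u) (v := v) (by simpa) (by simpa)
  rw [intervalIntegrable_iff_integrableOn_Ioo_of_le zero_le_one] at h ⊢
  refine IntegrableOn.congr_fun h.re (fun x hx => ?_) measurableSet_Ioo
  have h0 : (0 : ℝ) ≤ x := hx.1.le
  have h1 : (0 : ℝ) ≤ 1 - x := by linarith [hx.2]
  have e1 : ((x : ℂ) ^ ((u : ℂ) - 1)) = ((x ^ (u - 1) : ℝ) : ℂ) := by
    rw [Complex.ofReal_cpow h0]; push_cast; rfl
  have e2 : ((1 - x : ℂ) ^ ((v : ℂ) - 1)) = (((1 - x) ^ (v - 1) : ℝ) : ℂ) := by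
    rw [Complex.ofReal_cpow h1]; push_cast; rfl
  simp only [e1, e2, ← Complex.ofReal_mul]
  simp

theorem integral_beta {u v : ℝ} (hu : 0 < u) (hv : 0 < v) :
    ∫ x in (0 : ℝ)..1, x ^ (u - 1) * (1 - x) ^ (v - 1)
      = Real.Gamma u * Real.Gamma v / Real.Gamma (u + v) := by
  have h := ProbabilityTheory.beta_eq_betaIntegralReal u v hu hv
  rw [ProbabilityTheory.beta] at h
  rw [h, Complex.betaIntegral]
  have : ∫ x in (0 : ℝ)..1, (x : ℂ) ^ ((u : ℂ) - 1) * (1 - (x : ℂ)) ^ ((v : ℂ) - 1)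
      = ∫ x in (0 : ℝ)..1, ((x ^ (u - 1) * (1 - x) ^ (v - 1) : ℝ) : ℂ) := by
    refine intervalIntegral.integral_congr (fun x hx => ?_)
    rw [Set.uIcc_of_le zero_le_one] at hx
    have h0 : (0 : ℝ) ≤ x := hx.1
    have h1 : (0 : ℝ) ≤ 1 - x := by linarith [hx.2]
    simp only [Complex.ofReal_mul]
    rw [Complex.ofReal_cpow h0, Complex.ofReal_cpow h1]
    push_cast
    rfl
  rw [this, intervalIntegral.integral_ofReal, Complex.ofReal_re]

/-- The substitution y = (1 + x)/2 carries (-1, 1) to (0, 1). The exponents stay in the form `b + 1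
- 1` to match the beta integral with parameters b + 1 and a + 1. -/
theorem jacobiWeight_eq {a b x : ℝ} (hx : x ∈ Set.Ioo (-1 : ℝ) 1) :
    jacobiWeight a b x = 2 ^ (a + b) *
      ((1 / 2 * x + 1 / 2) ^ (b + 1 - 1) * (1 - (1 / 2 * x + 1 / 2)) ^ (a + 1 - 1)) := by
  have h0 : 0 < 1 + x := by linarith [hx.1]
  have h1 : 0 < 1 - x := by linarith [hx.2]
  have e0 : 1 / 2 * x + 1 / 2 = (1 + x) / 2 := by ring
  have e1 : 1 - (1 / 2 * x + 1 / 2) = (1 - x) / 2 := by ring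
  rw [e1, e0, add_sub_cancel_right, add_sub_cancel_right, jacobiWeight,
    Real.div_rpow h0.le zero_le_two, Real.div_rpow h1.le zero_le_two, Real.rpow_add two_pos]
  have := (Real.rpow_pos_of_pos two_pos a).ne'
  have := (Real.rpow_pos_of_pos two_pos b).ne'
  field_simp

theorem integrableOn_jacobiWeight {a b : ℝ} (ha : -1 < a) (hb : -1 < b) :
    IntegrableOn (jacobiWeight a b) (Set.Ioo (-1 : ℝ) 1) := by
  have h := intervalIntegrable_beta (u := b + 1) (v := a + 1) (by linarith) (by linarith)
  have h2 := ((h.comp_add_right (1 / 2)).comp_mul_left (c := 1 / 2)).const_mul (2 ^ (a + b))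
  norm_num at h2
  rw [intervalIntegrable_iff_integrableOn_Ioo_of_le (by norm_num)] at h2
  refine IntegrableOn.congr_fun h2 (fun x hx => ?_) measurableSet_Ioo
  rw [jacobiWeight_eq hx]
  norm_num

theorem integral_jacobiWeight {a b : ℝ} (ha : -1 < a) (hb : -1 < b) :
    ∫ x in Set.Ioo (-1 : ℝ) 1, jacobiWeight a b x
      = 2 ^ (a + b + 1) * Real.Gamma (a + 1) * Real.Gamma (b + 1) / Real.Gamma (a + b + 2) := by
  rw [setIntegral_congr_fun measurableSet_Ioo (fun x hx => jacobiWeight_eq hx),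
    ← integral_Ioc_eq_integral_Ioo, ← intervalIntegral.integral_of_le (by norm_num),
    intervalIntegral.integral_const_mul,
    intervalIntegral.integral_comp_mul_add
      (fun y : ℝ => y ^ (b + 1 - 1) * (1 - y) ^ (a + 1 - 1)) (by norm_num : (1 / 2 : ℝ) ≠ 0)]
  rw [show (1 / 2 * (-1) + 1 / 2 : ℝ) = 0 by norm_num, show (1 / 2 * 1 + 1 / 2 : ℝ) = 1 by norm_num,
    integral_beta (by linarith) (by linarith), Real.rpow_add_one two_ne_zero,
    show b + 1 + (a + 1) = a + b + 2 by ring, smul_eq_mul]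
  field_simp

/-! ### Integration against the Jacobi weight, as a linear functional -/

theorem integrableOn_eval_mul_jacobiWeight {a b : ℝ} (ha : -1 < a) (hb : -1 < b) (Q : ℝ[X]) :
    IntegrableOn (fun x => Q.eval x * jacobiWeight a b x) (Set.Ioo (-1 : ℝ) 1) := by
  have h := integrableOn_jacobiWeight ha hb
  rw [← intervalIntegrable_iff_integrableOn_Ioo_of_le (by norm_num)] at h ⊢
  exact h.continuousOn_mul Q.continuous.continuousOn

/-- `Q ↦ ∫ Q(x) (1 - x)^a (1 + x)^b dx` over `(-1, 1)`. -/
noncomputable def jacobiFunctional {a b : ℝ} (ha : -1 < a) (hb : -1 < b) : ℝ[X] →ₗ[ℝ] ℝ where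
  toFun Q := ∫ x in Set.Ioo (-1 : ℝ) 1, Q.eval x * jacobiWeight a b x
  map_add' P Q := by
    rw [← integral_add (integrableOn_eval_mul_jacobiWeight ha hb P)
      (integrableOn_eval_mul_jacobiWeight ha hb Q)]
    simp only [eval_add, add_mul]
  map_smul' c Q := by
    simp only [eval_smul, smul_eq_mul, mul_assoc, RingHom.id_apply]
    exact integral_const_mul _ _

theorem jacobiFunctional_apply {a b : ℝ} (ha : -1 < a) (hb : -1 < b) (Q : ℝ[X]) :
    jacobiFunctional ha hb Q = ∫ x in Set.Ioo (-1 : ℝ) 1, Q.eval x * jacobiWeight a b x := rfl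

theorem jacobiFunctional_C_mul {a b : ℝ} (ha : -1 < a) (hb : -1 < b) (c : ℝ) (Q : ℝ[X]) :
    jacobiFunctional ha hb (C c * Q) = c * jacobiFunctional ha hb Q := by
  rw [← smul_eq_C_mul, map_smul, smul_eq_mul]

/-- The powers only shift the parameters of the weight to a + p and b + q. The sign comes from x - 1
= -(1 - x). -/
theorem jacobiFunctional_moment {a b : ℝ} (ha : -1 < a) (hb : -1 < b) (p q : ℕ) :
    jacobiFunctional ha hb ((C (1 / 2 : ℝ) * (X - 1)) ^ p * (C (1 / 2 : ℝ) * (X + 1)) ^ q)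
      = (-1) ^ p * (2 ^ (a + b + 1) * Real.Gamma (a + p + 1) * Real.Gamma (b + q + 1)
          / Real.Gamma (a + b + p + q + 2)) := by
  have hp : (0 : ℝ) ≤ p := p.cast_nonneg
  have hq : (0 : ℝ) ≤ q := q.cast_nonneg
  have key : ∀ x ∈ Set.Ioo (-1 : ℝ) 1,
      ((C (1 / 2 : ℝ) * (X - 1)) ^ p * (C (1 / 2 : ℝ) * (X + 1)) ^ q).eval x * jacobiWeight a b x
        = ((-1) ^ p * (1 / 2) ^ p * (1 / 2) ^ q) * jacobiWeight (a + p) (b + q) x := by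
    intro x hx
    have h0 : 0 < 1 + x := by linarith [hx.1]
    have h1 : 0 < 1 - x := by linarith [hx.2]
    simp only [jacobiWeight, eval_mul, eval_pow, eval_C, eval_sub, eval_add, eval_X, eval_one]
    rw [Real.rpow_add_natCast h0.ne', Real.rpow_add_natCast h1.ne',
      show 1 / 2 * (x - 1) = (-1) * (1 / 2) * (1 - x) by ring]
    simp only [mul_pow, add_comm x 1]
    ring
  rw [jacobiFunctional_apply, setIntegral_congr_fun measurableSet_Ioo key, integral_const_mul,
    integral_jacobiWeight (by linarith) (by linarith),
    show a + p + (b + q) + 1 = a + b + 1 + p + q by ring, Real.rpow_add_natCast two_ne_zero,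
    Real.rpow_add_natCast two_ne_zero, show a + p + (b + q) + 2 = a + b + p + q + 2 by ring]
  simp only [one_div, inv_pow]
  field_simp

/-! ### Rising factorials and generalized binomial coefficients -/

@[simp] theorem rising_zero (x : ℝ) : rising x 0 = 1 := by simp [rising]

theorem rising_succ (x : ℝ) (k : ℕ) : rising x (k + 1) = rising x k * (x + k) := by
  simp [rising, ascPochhammer_succ_eval]

theorem rising_succ_left (x : ℝ) (k : ℕ) : rising x (k + 1) = x * rising (x + 1) k := by
  simp [rising, ascPochhammer_succ_left]

theorem rising_eq_Gamma_div_of_pos {x : ℝ} (hx : 0 < x) (k : ℕ) :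
    rising x k = Real.Gamma (x + k) / Real.Gamma x :=
  rising_eq_Gamma_div x k fun m h => by
    have : (0 : ℝ) ≤ m := m.cast_nonneg
    linarith

theorem rising_neg_natCast (n k : ℕ) : rising (-(n : ℝ)) k = (-1) ^ k * n.descFactorial k := by
  induction k with
  | zero => simp
  | succ k ih =>
    rw [rising_succ, ih, Nat.descFactorial_succ]
    rcases le_or_gt k n with h | h
    · push_cast [Nat.cast_sub h]; ring
    · simp [Nat.descFactorial_of_lt h]

theorem choose_add_eq_rising (x : ℝ) (k : ℕ) :
    Ring.choose (x + k) k = rising (x + 1) k / k.factorial := by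
  have h := Ring.factorial_nsmul_multichoose_eq_ascPochhammer (x + 1) k
  rw [Ring.multichoose_eq, ascPochhammer_smeval_eq_eval, nsmul_eq_mul,
    show x + 1 + (k : ℝ) - 1 = x + k by ring] at h
  rw [rising, ← h]
  field_simp

theorem choose_eq_Gamma {y : ℝ} {m : ℕ} (h : 0 < y - m + 1) :
    Ring.choose y m
      = Real.Gamma (y + 1) / ((m.factorial : ℝ) * Real.Gamma (y - m + 1)) := by
  have := choose_add_eq_rising (y - m) m
  rw [sub_add_cancel] at this
  rw [this, rising_eq_Gamma_div_of_pos h, show y - m + 1 + m = y + 1 by ring, div_div, mul_comm]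

theorem rising_add_one_sub (x : ℝ) (q : ℕ) :
    rising (x + 1) q - rising x q = q * rising (x + 1) (q - 1) := by
  cases q with
  | zero => simp
  | succ q =>
    rw [rising_succ, rising_succ_left, Nat.add_sub_cancel]
    push_cast
    ring

/-- Rising factorials behave under Δ as monomials do under d/dx: Δ(y)_p = p (y+1)_{p-1}. For n > p
the descending factorial vanishes, so the truncated p - n is harmless. -/
theorem fwdDiff_iter_rising (c : ℝ) (p n : ℕ) :
    (fwdDiff (1 : ℝ))^[n] (fun y => rising (c + y) p)
      = fun y => (p.descFactorial n : ℝ) * rising (c + n + y) (p - n) := by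
  induction n with
  | zero => simp
  | succ n ih =>
    rw [Function.iterate_succ_apply', ih]
    funext y
    have := rising_add_one_sub (c + n + y) (p - n)
    rw [fwdDiff, ← mul_sub, ← add_assoc, this, Nat.descFactorial_succ, Nat.sub_sub]
    push_cast
    rw [show c + n + y + 1 = c + (n + 1) + y by ring]
    ring

/-- The `n`-th forward difference of a rising factorial of length `p`. -/
theorem sum_neg_one_pow_mul_choose_mul_rising (c : ℝ) (p n : ℕ) :
    ∑ l ∈ Finset.range (n + 1), (-1 : ℝ) ^ (n - l) * n.choose l * rising (c + l) p
      = (p.descFactorial n : ℝ) * rising (c + n) (p - n) := by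
  have h := fwdDiff_iter_eq_sum_shift (1 : ℝ) (fun y => rising (c + y) p) n 0
  rw [fwdDiff_iter_rising] at h
  simpa using h.symm

/-! ### Algebraic properties of the Jacobi polynomials -/

/-- The range of m is extended from l to n, at the cost of zero terms, so that it no longer depends
on l and the double sum below can be interchanged. -/
theorem pow_mul_one_add_pow {R : Type*} [CommRing R] (V : R) {n l : ℕ} (hl : l ≤ n) :
    V ^ (n - l) * (V + 1) ^ l = ∑ m ∈ Finset.range (n + 1), (l.choose m : R) * V ^ (n - m) := by
  rw [add_comm V 1, add_pow, Finset.mul_sum]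
  rw [← Finset.sum_subset (Finset.range_mono (Nat.succ_le_succ hl) :
    Finset.range (l + 1) ⊆ Finset.range (n + 1))]
  · refine Finset.sum_congr rfl fun m hm => ?_
    have hm : m ≤ l := Nat.lt_succ_iff.mp (Finset.mem_range.mp hm)
    rw [show n - m = (n - l) + (l - m) by omega, pow_add]
    ring
  · intro m _ hm
    rw [Nat.choose_eq_zero_of_lt (by simpa using hm)]
    simp

/-- The expansion of the Jacobi polynomials in the products of powers of `x - 1` and `x + 1`. -/
theorem jacobi_eq_sum_choose (a b : ℝ) (n : ℕ) :
    jacobi a b n = ∑ l ∈ Finset.range (n + 1),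
      C (Ring.choose (n + a) l * Ring.choose (n + b) (n - l))
        * ((C (1 / 2 : ℝ) * (X - 1)) ^ (n - l) * (C (1 / 2 : ℝ) * (X + 1)) ^ l) := by
  set V : ℝ[X] := C (1 / 2 : ℝ) * (X - 1) with hV
  have hU : C (1 / 2 : ℝ) * (X + 1) = V + 1 := by
    have : C (1 / 2 : ℝ) + C (1 / 2 : ℝ) = (1 : ℝ[X]) := by
      rw [← C_add, ← C_1]; norm_num
    rw [hV]
    linear_combination this
  rw [hU, jacobi, ← hV, ← Finset.sum_range_reflect]
  have e : ∀ l ∈ Finset.range (n + 1),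
      C (Ring.choose (n + a) l * Ring.choose (n + b) (n - l)) * (V ^ (n - l) * (V + 1) ^ l)
        = ∑ m ∈ Finset.range (n + 1),
          C (Ring.choose (n + a) l * Ring.choose (n + b) (n - l) * (l.choose m : ℝ))
            * V ^ (n - m) := by
    intro l hl
    rw [pow_mul_one_add_pow V (Nat.lt_succ_iff.mp (Finset.mem_range.mp hl)), Finset.mul_sum]
    refine Finset.sum_congr rfl fun m _ => ?_
    rw [C_mul, C_mul, C_mul, ← mul_assoc, C_eq_natCast]
  rw [Finset.sum_congr rfl e, Finset.sum_comm]
  refine Finset.sum_congr rfl fun m hm => ?_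
  have hm : m ≤ n := Nat.lt_succ_iff.mp (Finset.mem_range.mp hm)
  rw [← Finset.sum_mul, ← map_sum, show n + 1 - 1 - m = n - m by omega]
  congr 2
  -- With n = m + j, the terms l < m of the coefficient of V^(n-m) vanish. In the others, moving the
  -- factor choose l m onto choose (n+a) l leaves a Vandermonde convolution of length j.
  obtain ⟨j, rfl⟩ := Nat.exists_eq_add_of_le hm
  rw [show m + j + 1 = m + (j + 1) by ring, Finset.sum_range_add, Finset.sum_eq_zero, zero_add]
  · have e2 : ∀ l ∈ Finset.range (j + 1),
        Ring.choose (((m + j : ℕ) : ℝ) + a) (m + l)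
            * Ring.choose (((m + j : ℕ) : ℝ) + b) (m + j - (m + l)) * ((m + l).choose m : ℝ)
          = Ring.choose (((m + j : ℕ) : ℝ) + a) m * (Ring.choose (j + a) l
            * Ring.choose (((m + j : ℕ) : ℝ) + b) (j - l)) := by
      intro l _
      have := Ring.choose_smul_choose (((m + j : ℕ) : ℝ) + a) (Nat.le_add_right m l)
      rw [Nat.add_sub_cancel_left, nsmul_eq_mul,
        show ((m + j : ℕ) : ℝ) + a - m = j + a by push_cast; ring] at this
      rw [Nat.add_sub_add_left]
      linear_combination Ring.choose (((m + j : ℕ) : ℝ) + b) (j - l) * this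
    rw [Finset.sum_congr rfl e2, ← Finset.mul_sum]
    have vd := Ring.add_choose_eq (r := (j : ℝ) + a) (s := ((m + j : ℕ) : ℝ) + b) j
      (Commute.all _ _)
    rw [Finset.Nat.sum_antidiagonal_eq_sum_range_succ_mk] at vd
    rw [← vd, Nat.add_sub_cancel_left,
      show (j : ℝ) + a + (((m + j : ℕ) : ℝ) + b) = ((m + j : ℕ) : ℝ) + a + b + j by ring,
      show ((m + j : ℕ) : ℝ) + a = (a + j) + m by push_cast; ring,
      choose_add_eq_rising, show (a + j) + m + b + (j : ℝ) = (a + j + m + b) + j by ring,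
      choose_add_eq_rising, Nat.add_sub_cancel]
    have hf : ((m + j).choose j : ℝ) * (m.factorial * j.factorial) = (m + j).factorial := by
      have := Nat.add_choose_mul_factorial_mul_factorial m j
      rw [mul_assoc] at this
      exact_mod_cast this
    rw [← hf]
    have : ((m + j).choose j : ℝ) ≠ 0 := by
      exact_mod_cast (Nat.choose_pos (Nat.le_add_left j m)).ne'
    field_simp
  · intro l hl
    rw [Nat.choose_eq_zero_of_lt (Finset.mem_range.mp hl)]
    simp

@[simp] theorem jacobi_zero (a b : ℝ) : jacobi a b 0 = 1 := by simp [jacobi]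

theorem derivative_jacobi_succ (a b : ℝ) (n : ℕ) :
    derivative (jacobi a b (n + 1)) = C ((n + a + b + 2) / 2) * jacobi (a + 1) (b + 1) n := by
  rw [jacobi, derivative_sum, Finset.sum_range_succ', jacobi, Finset.mul_sum]
  simp only [pow_zero, mul_one, derivative_C, add_zero]
  refine Finset.sum_congr rfl fun j _ => ?_
  rw [derivative_C_mul, derivative_pow]
  simp only [derivative_C_mul, derivative_sub, derivative_X, derivative_one, sub_zero, mul_one,
    Nat.add_sub_cancel]
  rw [show ∀ u v w z : ℝ[X], u * (v * w * z) = (u * v * z) * w by intros; ring, ← C_mul, ← C_mul,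
    ← mul_assoc, ← C_mul]
  congr 2
  have hc : ((n + 1).choose (j + 1) : ℝ) * (j + 1) = (n + 1) * n.choose j := by
    exact_mod_cast (Nat.add_one_mul_choose_eq n j).symm
  rw [Nat.add_sub_add_right, rising_succ_left, Nat.factorial_succ,
    show ((n + 1 : ℕ) : ℝ) + a + b + 1 + 1 = n + (a + 1) + (b + 1) + 1 by push_cast; ring,
    show a + ((j + 1 : ℕ) : ℝ) + 1 = a + 1 + j + 1 by push_cast; ring]
  push_cast
  field_simp
  linear_combination (rising (n + (a + 1) + (b + 1) + 1) j * rising (a + 1 + j + 1) (n - j)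
    * (n + a + b + 2)) * hc

theorem iterate_derivative_jacobi_add (a b : ℝ) (n r : ℕ) :
    derivative^[r] (jacobi a b (n + r))
      = C ((1 / 2) ^ r * rising (n + r + a + b + 1) r) * jacobi (a + r) (b + r) n := by
  induction r generalizing a b with
  | zero => simp
  | succ r ih =>
    rw [Function.iterate_succ_apply, ← add_assoc, derivative_jacobi_succ, iterate_derivative_C_mul,
      ih, ← mul_assoc, ← C_mul, rising_succ_left]
    push_cast
    rw [show (n : ℝ) + r + (a + 1) + (b + 1) + 1 = n + (r + 1) + a + b + 1 + 1 by ring,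
      show a + 1 + (r : ℝ) = a + (r + 1) by ring, show b + 1 + (r : ℝ) = b + (r + 1) by ring]
    congr 2
    ring

theorem natDegree_jacobi_le (a b : ℝ) (n : ℕ) : (jacobi a b n).natDegree ≤ n := by
  refine natDegree_sum_le_of_forall_le _ _ fun j hj => ?_
  refine (natDegree_C_mul_le _ _).trans ((natDegree_pow_le_of_le j
    ((natDegree_C_mul_le _ _).trans (natDegree_X_sub_C_le 1))).trans ?_)
  rw [mul_one]
  exact Nat.lt_succ_iff.mp (Finset.mem_range.mp hj)

theorem iterate_derivative_jacobi_self (a b : ℝ) (n : ℕ) :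
    derivative^[n] (jacobi a b n) = C ((1 / 2) ^ n * rising (n + a + b + 1) n) := by
  simpa using iterate_derivative_jacobi_add a b 0 n

theorem iterate_derivative_jacobi_of_lt (a b : ℝ) {n r : ℕ} (h : n < r) :
    derivative^[r] (jacobi a b n) = 0 :=
  iterate_derivative_eq_zero ((natDegree_jacobi_le a b n).trans_lt h)

theorem iterate_derivative_half_mul_X_add_one_pow (p r : ℕ) :
    derivative^[r] ((C (1 / 2 : ℝ) * (X + 1)) ^ p)
      = C ((1 / 2) ^ r * (p.descFactorial r : ℝ)) * (C (1 / 2 : ℝ) * (X + 1)) ^ (p - r) := by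
  induction r with
  | zero => simp
  | succ r ih =>
    rw [Function.iterate_succ_apply', ih, derivative_C_mul, derivative_pow, Nat.descFactorial_succ]
    simp only [derivative_C_mul, derivative_add, derivative_X, derivative_one, add_zero, mul_one]
    rw [show ∀ u v w z : ℝ[X], u * (v * w * z) = (u * v * z) * w by intros; ring, ← C_mul, ← C_mul,
      Nat.sub_sub]
    congr 2
    push_cast
    ring

/-! ### The Rodrigues formula in weak form, and the norms -/

theorem neg_one_lt_add_natCast {a : ℝ} (ha : -1 < a) (i : ℕ) : -1 < a + i := by
  have : (0 : ℝ) ≤ i := i.cast_nonneg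
  linarith

/-- In every term of the expansion the exponents add up to p + i, so the denominator of the beta
integral is independent of l. The binomials cancel the Gamma factors in a, and an i-th forward
difference of (b+1+l)_p remains. -/
theorem jacobiFunctional_pow_mul_jacobi {a b : ℝ} (ha : -1 < a) (hb : -1 < b) (p i : ℕ) :
    jacobiFunctional ha hb ((C (1 / 2 : ℝ) * (X + 1)) ^ p * jacobi a b i)
      = (p.descFactorial i : ℝ) / i.factorial * (2 ^ (a + b + 1) * Real.Gamma (a + i + 1)
          * Real.Gamma (b + i + 1) * rising (b + i + 1) (p - i)
          / Real.Gamma (a + b + p + i + 2)) := by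
  rw [jacobi_eq_sum_choose, Finset.mul_sum, map_sum]
  have e : ∀ l ∈ Finset.range (i + 1),
      jacobiFunctional ha hb ((C (1 / 2 : ℝ) * (X + 1)) ^ p *
        (C (Ring.choose (i + a) l * Ring.choose (i + b) (i - l))
          * ((C (1 / 2 : ℝ) * (X - 1)) ^ (i - l) * (C (1 / 2 : ℝ) * (X + 1)) ^ l)))
      = (2 ^ (a + b + 1) * Real.Gamma (a + i + 1) * Real.Gamma (b + i + 1)
          / (i.factorial * Real.Gamma (a + b + p + i + 2)))
        * ((-1) ^ (i - l) * i.choose l * rising (b + 1 + l) p) := by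
    intro l hl
    have hl : l ≤ i := Nat.lt_succ_iff.mp (Finset.mem_range.mp hl)
    have hc : ((i - l : ℕ) : ℝ) = i - l := Nat.cast_sub hl
    have hli : (l : ℝ) ≤ i := by exact_mod_cast hl
    have hl0 : (0 : ℝ) ≤ l := l.cast_nonneg
    have h1 : 0 < a + i - l + 1 := by linarith
    have h2 : 0 < b + 1 + l := by linarith
    rw [show ∀ u v w z : ℝ[X], u * (v * (w * z)) = v * (w * (z * u)) by intros; ring, ← pow_add,
      jacobiFunctional_C_mul, jacobiFunctional_moment, choose_eq_Gamma (by linarith),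
      choose_eq_Gamma (by linarith), rising_eq_Gamma_div_of_pos h2, Nat.cast_choose ℝ hl, hc]
    push_cast
    rw [show (i : ℝ) + a + 1 = a + i + 1 by ring, show (i : ℝ) + b + 1 = b + i + 1 by ring,
      show (i : ℝ) + a - l + 1 = a + i - l + 1 by ring,
      show a + ((i : ℝ) - l) + 1 = a + i - l + 1 by ring,
      show (i : ℝ) + b - (i - l) + 1 = b + 1 + l by ring,
      show b + ((l : ℝ) + p) + 1 = b + 1 + l + p by ring,
      show a + b + ((i : ℝ) - l) + (l + p) + 2 = a + b + p + i + 2 by ring]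
    have := (Real.Gamma_pos_of_pos h1).ne'
    have := (Real.Gamma_pos_of_pos h2).ne'
    field_simp
  rw [Finset.sum_congr rfl e, ← Finset.mul_sum, sum_neg_one_pow_mul_choose_mul_rising,
    show b + 1 + (i : ℝ) = b + i + 1 by ring]
  ring

/-- Every Q is R((x+1)/2) with R(x) = Q(2x - 1), so the powers of (x+1)/2 span. -/
theorem polynomial_induction_half {motive : ℝ[X] → Prop} (add : ∀ P Q, motive P → motive Q →
    motive (P + Q)) (mon : ∀ (c : ℝ) (p : ℕ), motive (C c * (C (1 / 2 : ℝ) * (X + 1)) ^ p))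
    (Q : ℝ[X]) : motive Q := by
  have h : ∀ R : ℝ[X], motive (R.comp (C (1 / 2 : ℝ) * (X + 1))) := by
    intro R
    induction R using Polynomial.induction_on' with
    | add P Q hP hQ => rw [add_comp]; exact add _ _ hP hQ
    | monomial n c => rw [monomial_comp]; exact mon c n
  have e : (Q.comp (C 2 * X - 1)).comp (C (1 / 2 : ℝ) * (X + 1)) = Q := by
    rw [comp_assoc]
    have : (C 2 * X - 1 : ℝ[X]).comp (C (1 / 2 : ℝ) * (X + 1)) = X := by
      have hc : (C 2 * C (1 / 2 : ℝ) : ℝ[X]) = 1 := by rw [← C_mul, ← C_1]; norm_num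
      simp only [sub_comp, mul_comp, C_comp, X_comp, one_comp]
      linear_combination (X + 1) * hc
    rw [this, comp_X]
  rw [← e]
  exact h _

/-- Repeated integration by parts against the Rodrigues formula. -/
theorem jacobiFunctional_mul_jacobi {a b : ℝ} (ha : -1 < a) (hb : -1 < b) (i : ℕ) (Q : ℝ[X]) :
    jacobiFunctional ha hb (Q * jacobi a b i)
      = 1 / (2 ^ i * i.factorial) * jacobiFunctional (neg_one_lt_add_natCast ha i)
          (neg_one_lt_add_natCast hb i) (derivative^[i] Q) := by
  induction Q using polynomial_induction_half with
  | add P Q hP hQ => rw [add_mul, map_add, hP, hQ, iterate_map_add, map_add, mul_add]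
  | mon c p =>
    rw [mul_assoc, jacobiFunctional_C_mul, jacobiFunctional_pow_mul_jacobi,
      iterate_derivative_C_mul, iterate_derivative_half_mul_X_add_one_pow,
      jacobiFunctional_C_mul, jacobiFunctional_C_mul]
    -- For i ≤ p both sides are closed Gamma expressions; for p < i both vanish, through the
    -- descending factorial.
    rcases le_or_gt i p with h | h
    · have m := jacobiFunctional_moment (neg_one_lt_add_natCast ha i)
        (neg_one_lt_add_natCast hb i) 0 (p - i)
      rw [pow_zero, one_mul] at m
      have hb0 : 0 < b + i + 1 := by have := neg_one_lt_add_natCast hb i; linarith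
      rw [m, rising_eq_Gamma_div_of_pos hb0, Nat.cast_sub h,
        show a + i + (b + i) + 1 = a + b + 1 + i + i by ring, Real.rpow_add_natCast two_ne_zero,
        Real.rpow_add_natCast two_ne_zero]
      have := (Real.Gamma_pos_of_pos hb0).ne'
      rw [show a + i + (b + i) + ((0 : ℕ) : ℝ) + ((p : ℝ) - i) + 2 = a + b + p + i + 2 by
          push_cast; ring,
        show b + (i : ℝ) + (p - i) + 1 = b + i + 1 + (p - i) by ring]
      push_cast
      simp only [add_zero, pow_zero, one_mul, one_div, inv_pow]
      field_simp
    · rw [Nat.descFactorial_of_lt h]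
      simp

theorem gammaFactor_pos {t : ℝ} (ht : -1 < t) (j : ℕ) : 0 < gammaFactor t j := by
  unfold gammaFactor
  split_ifs with h
  · exact Real.Gamma_pos_of_pos (by linarith)
  · have : (1 : ℝ) ≤ j := by exact_mod_cast Nat.one_le_iff_ne_zero.mpr h
    exact mul_pos (by linarith) (Real.Gamma_pos_of_pos (by linarith))

/-- `(j + t)_j (t + 2j) Γ(t + j) = Γ(t + 2j + 1)`. -/
theorem rising_mul_gammaFactor {t : ℝ} (ht : -1 < t) (j : ℕ) :
    rising (j + t) j * gammaFactor t j = Real.Gamma (t + 2 * j + 1) := by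
  unfold gammaFactor
  split_ifs with h
  · subst h; simp
  · have : (1 : ℝ) ≤ j := by exact_mod_cast Nat.one_le_iff_ne_zero.mpr h
    have h0 : 0 < j + t := by linarith
    have := (Real.Gamma_pos_of_pos h0).ne'
    rw [rising_eq_Gamma_div_of_pos h0, Real.Gamma_add_one (by linarith),
      show (j : ℝ) + t + j = t + 2 * j by ring, show t + (j : ℝ) = j + t by ring]
    field_simp

theorem jacobiNorm_pos {a b : ℝ} (ha : -1 < a) (hb : -1 < b) (j : ℕ) : 0 < jacobiNorm a b j := by
  have h1 := neg_one_lt_add_natCast ha j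
  have h2 := neg_one_lt_add_natCast hb j
  have h3 := gammaFactor_pos (t := a + b + 1) (by linarith) j
  have h4 : 0 < Real.Gamma (a + j + 1) := Real.Gamma_pos_of_pos (by linarith)
  have h5 : 0 < Real.Gamma (b + j + 1) := Real.Gamma_pos_of_pos (by linarith)
  unfold jacobiNorm
  positivity

theorem jacobiFunctional_jacobi_mul_self {a b : ℝ} (ha : -1 < a) (hb : -1 < b) (j : ℕ) :
    jacobiFunctional ha hb (jacobi a b j * jacobi a b j) = jacobiNorm a b j := by
  have m := jacobiFunctional_moment (neg_one_lt_add_natCast ha j)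
    (neg_one_lt_add_natCast hb j) 0 0
  rw [pow_zero, pow_zero, one_mul] at m
  rw [jacobiFunctional_mul_jacobi, iterate_derivative_jacobi_self, ← mul_one (C _),
    jacobiFunctional_C_mul, m]
  have hg := gammaFactor_pos (t := a + b + 1) (by linarith) j
  have hr := rising_mul_gammaFactor (t := a + b + 1) (by linarith) j
  have h0 : (0 : ℝ) < a + b + 1 + 2 * j + 1 := by
    have := neg_one_lt_add_natCast ha j
    have := neg_one_lt_add_natCast hb j
    linarith
  have hG := (Real.Gamma_pos_of_pos h0).ne'
  rw [jacobiNorm, show a + j + (b + j) + 1 = a + b + 1 + j + j by ring,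
    Real.rpow_add_natCast two_ne_zero, Real.rpow_add_natCast two_ne_zero,
    show a + j + (b + j) + ((0 : ℕ) : ℝ) + ((0 : ℕ) : ℝ) + 2 = a + b + 1 + 2 * j + 1 by
      push_cast; ring,
    show (j : ℝ) + a + b + 1 = j + (a + b + 1) by ring]
  rw [← hr] at hG ⊢
  simp only [Nat.cast_zero, add_zero, one_div, inv_pow, pow_zero, one_mul]
  have := left_ne_zero_of_mul hG
  field_simp

/-- The factor of lower degree is killed by the derivatives moved onto it. -/
theorem jacobiFunctional_jacobi_mul_jacobi {a b : ℝ} (ha : -1 < a) (hb : -1 < b) (i j : ℕ) :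
    jacobiFunctional ha hb (jacobi a b i * jacobi a b j)
      = jacobiNorm a b j * (if i = j then 1 else 0) := by
  rcases lt_trichotomy i j with h | h | h
  · rw [jacobiFunctional_mul_jacobi, iterate_derivative_jacobi_of_lt a b h, if_neg h.ne]
    simp
  · subst h
    rw [jacobiFunctional_jacobi_mul_self]
    simp
  · rw [mul_comm, jacobiFunctional_mul_jacobi, iterate_derivative_jacobi_of_lt a b h,
      if_neg h.ne']
    simp

/-! ### Expansion in Jacobi polynomials -/

/-- Up to n! the coefficient is the constant n-th derivative 2^{-n} (n+a+b+1)_n. Its rising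
factorial is nonzero because it divides Γ(a+b+2n+2) > 0. -/
theorem coeff_jacobi_self_ne_zero {a b : ℝ} (ha : -1 < a) (hb : -1 < b) (n : ℕ) :
    (jacobi a b n).coeff n ≠ 0 := by
  intro h
  have e := congrArg (fun p => p.coeff 0) (iterate_derivative_jacobi_self a b n)
  simp only [coeff_iterate_derivative, zero_add, h, smul_zero, coeff_C_zero] at e
  have hg := rising_mul_gammaFactor (t := a + b + 1) (by linarith) n
  have h0 : (0 : ℝ) < a + b + 1 + 2 * n + 1 := by
    have := neg_one_lt_add_natCast ha n
    have := neg_one_lt_add_natCast hb n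
    linarith
  have hG := Real.Gamma_pos_of_pos h0
  rw [← hg, show (n : ℝ) + (a + b + 1) = n + a + b + 1 by ring] at hG
  rcases mul_eq_zero.mp e.symm with h1 | h1
  · exact absurd h1 (by positivity)
  · rw [h1, zero_mul] at hG
    exact hG.false

theorem exists_eq_sum_jacobi {a b : ℝ} (ha : -1 < a) (hb : -1 < b) (N : ℕ) (Q : ℝ[X])
    (hQ : Q.degree < N) :
    ∃ c : ℕ → ℝ, Q = ∑ i ∈ Finset.range N, C (c i) * jacobi a b i := by
  induction N generalizing Q with
  | zero => exact ⟨0, by simpa [degree_eq_bot] using hQ⟩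
  | succ N ih =>
    set d := Q.coeff N / (jacobi a b N).coeff N with hd
    have hR : (Q - C d * jacobi a b N).degree < N := by
      rw [degree_lt_iff_coeff_zero]
      intro m hm
      rw [coeff_sub, coeff_C_mul]
      rcases hm.eq_or_lt with rfl | hm
      · rw [hd, div_mul_cancel₀ _ (coeff_jacobi_self_ne_zero ha hb N), sub_self]
      · rw [coeff_eq_zero_of_degree_lt (hQ.trans_le (by exact_mod_cast hm)),
          coeff_eq_zero_of_natDegree_lt ((natDegree_jacobi_le a b N).trans_lt hm), mul_zero,
          sub_zero]
    obtain ⟨c, hc⟩ := ih (Q - C d * jacobi a b N) hR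
    refine ⟨fun i => if i = N then d else c i, ?_⟩
    rw [Finset.sum_range_succ, ← sub_eq_iff_eq_add]
    simp only [if_true]
    rw [hc]
    refine Finset.sum_congr rfl fun i hi => ?_
    rw [if_neg (Finset.mem_range.mp hi).ne]

/-- A polynomial is the sum of its Jacobi series. -/
theorem eq_sum_jacobi_of_forall {a b : ℝ} (ha : -1 < a) (hb : -1 < b) {N : ℕ} {Q : ℝ[X]}
    (hQ : Q.degree < N) {c : ℕ → ℝ}
    (hc : ∀ i < N, jacobiFunctional ha hb (Q * jacobi a b i) = c i * jacobiNorm a b i) :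
    Q = ∑ i ∈ Finset.range N, C (c i) * jacobi a b i := by
  obtain ⟨d, hd⟩ := exists_eq_sum_jacobi ha hb N Q hQ
  refine hd.trans (Finset.sum_congr rfl fun i hi => ?_)
  have h := hc i (Finset.mem_range.mp hi)
  rw [hd, Finset.sum_mul, map_sum, Finset.sum_eq_single_of_mem i hi] at h
  · rw [mul_assoc, jacobiFunctional_C_mul, jacobiFunctional_jacobi_mul_self] at h
    rw [mul_right_cancel₀ (jacobiNorm_pos ha hb i).ne' h]
  · intro j _ hj
    rw [mul_assoc, jacobiFunctional_C_mul, jacobiFunctional_jacobi_mul_jacobi, if_neg hj]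
    simp

/-! ### Terminating hypergeometric series -/

theorem rising_neg (y : ℝ) (l : ℕ) : rising (-y) l = (-1) ^ l * rising (y - l + 1) l := by
  induction l with
  | zero => simp
  | succ l ih =>
    rw [rising_succ, ih, rising_succ_left]
    push_cast
    rw [show y - (l + 1) + 1 + 1 = y - l + 1 by ring]
    ring

theorem rising_neg_eq_Gamma {y : ℝ} {l : ℕ} (h : 0 < y - l + 1) :
    rising (-y) l = (-1) ^ l * (Real.Gamma (y + 1) / Real.Gamma (y - l + 1)) := by
  rw [rising_neg, rising_eq_Gamma_div_of_pos h, show y - l + 1 + (l : ℝ) = y + 1 by ring]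

/-- For t > n the numerator contains (-n)_t = 0, so the term is zero even where a lower parameter
makes the denominator vanish. -/
theorem hyp32_neg_natCast (n : ℕ) (a₂ a₃ b₁ b₂ x : ℝ) :
    hyp32 (-(n : ℝ)) a₂ a₃ b₁ b₂ x
      = ∑ t ∈ Finset.range (n + 1), rising (-(n : ℝ)) t * rising a₂ t * rising a₃ t
          / (rising b₁ t * rising b₂ t * (t.factorial : ℝ)) * x ^ t := by
  refine tsum_eq_sum fun t ht => ?_
  rw [rising_neg_natCast, Nat.descFactorial_of_lt (by simpa using ht)]
  simp

theorem ordinaryHypergeometric_neg_natCast (q : ℕ) (b c x : ℝ) :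
    ordinaryHypergeometric (-(q : ℝ)) b c x
      = ∑ t ∈ Finset.range (q + 1), (-x) ^ t * q.choose t * (rising b t / rising c t) := by
  rw [ordinaryHypergeometric_eq_tsum]
  have e : ∀ t : ℕ, ((t.factorial : ℝ)⁻¹ * (ascPochhammer ℝ t).eval (-(q : ℝ))
      * (ascPochhammer ℝ t).eval b * ((ascPochhammer ℝ t).eval c)⁻¹) • x ^ t
      = (-x) ^ t * q.choose t * (rising b t / rising c t) := by
    intro t
    have h := rising_neg_natCast q t
    rw [rising] at h
    rw [h, Nat.descFactorial_eq_factorial_mul_choose, rising, rising, smul_eq_mul, neg_pow x]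
    push_cast
    field_simp
  simp only [e]
  refine tsum_eq_sum fun t ht => ?_
  rw [Nat.choose_eq_zero_of_lt (by simpa using ht)]
  simp

/-! ### Integrals of `x ^ q` times a Jacobi polynomial against another Jacobi weight -/

/-- With U = (x+1)/2 one has x = -(1 - 2U). The binomial expansion of x^q in powers of U gives beta
integrals whose ratios to the t = 0 term form the terminating ₂F₁ at 2. -/
theorem jacobiFunctional_X_pow_moment {a b : ℝ} (ha : -1 < a) (hb : -1 < b) (q p r : ℕ) :
    jacobiFunctional ha hb
        (X ^ q * ((C (1 / 2 : ℝ) * (X - 1)) ^ p * (C (1 / 2 : ℝ) * (X + 1)) ^ r))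
      = (-1) ^ (p + q) * (2 ^ (a + b + 1) * Real.Gamma (a + p + 1) * Real.Gamma (b + r + 1)
          / Real.Gamma (a + b + p + r + 2))
          * ordinaryHypergeometric (-(q : ℝ)) (b + r + 1) (a + b + p + r + 2) (2 : ℝ) := by
  have hX : (X : ℝ[X]) ^ q = ∑ t ∈ Finset.range (q + 1),
      C ((-1 : ℝ) ^ q * ((-2) ^ t * (q.choose t : ℝ))) * (C (1 / 2 : ℝ) * (X + 1)) ^ t := by
    have h2 : (C 2 * C (1 / 2 : ℝ) : ℝ[X]) = 1 := by rw [← C_mul, ← C_1]; norm_num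
    have hx : (X : ℝ[X]) = (-1) * (C (-2) * (C (1 / 2 : ℝ) * (X + 1)) + 1) := by
      rw [C_neg]
      linear_combination -(X + 1) * h2
    conv_lhs => rw [hx]
    rw [mul_pow, add_pow, Finset.mul_sum]
    refine Finset.sum_congr rfl fun t _ => ?_
    simp only [C_mul, C_pow, C_neg, C_1, one_pow, mul_one, mul_pow, ← C_eq_natCast]
    ring
  have hb0 : 0 < b + r + 1 := by have := neg_one_lt_add_natCast hb r; linarith
  have hc0 : 0 < a + b + p + r + 2 := by have := neg_one_lt_add_natCast ha p; linarith
  have h1 := (Real.Gamma_pos_of_pos hb0).ne'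
  have h2 := (Real.Gamma_pos_of_pos hc0).ne'
  rw [ordinaryHypergeometric_neg_natCast, hX, Finset.sum_mul, map_sum, Finset.mul_sum]
  refine Finset.sum_congr rfl fun t _ => ?_
  rw [show ∀ u v w z : ℝ[X], u * v * (w * z) = u * (w * (z * v)) by intros; ring, ← pow_add,
    jacobiFunctional_C_mul, jacobiFunctional_moment, rising_eq_Gamma_div_of_pos hb0,
    rising_eq_Gamma_div_of_pos hc0, pow_add]
  push_cast
  rw [show b + ((r : ℝ) + t) + 1 = b + r + 1 + t by ring,
    show a + b + p + ((r : ℝ) + t) + 2 = a + b + p + r + 2 + t by ring]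
  have : 0 < a + b + p + r + 2 + t := by have : (0 : ℝ) ≤ t := t.cast_nonneg; linarith
  have h3 := (Real.Gamma_pos_of_pos this).ne'
  field_simp

/-- The polynomial and the weight have independent parameters, because differentiation and
`jacobiFunctional_mul_jacobi` shift them separately. -/
theorem jacobiFunctional_X_pow_mul_jacobi {a b A B : ℝ} (ha : -1 < a) (hb : -1 < b) (hA : -1 < A)
    (hB : -1 < B) (q n : ℕ) :
    jacobiFunctional ha hb (X ^ q * jacobi A B n)
      = ∑ l ∈ Finset.range (n + 1),
          (-1) ^ (n - l + q) * (2 ^ (a + b + 1) * Real.Gamma (n + A + 1) * Real.Gamma (n + B + 1)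
              * Real.Gamma (a + n - l + 1) * Real.Gamma (b + l + 1))
            / ((l.factorial : ℝ) * ((n - l).factorial : ℝ) * Real.Gamma (n + A - l + 1)
              * Real.Gamma (B + l + 1) * Real.Gamma (a + b + n + 2))
            * ordinaryHypergeometric (-(q : ℝ)) (b + l + 1) (a + b + n + 2) (2 : ℝ) := by
  rw [jacobi_eq_sum_choose, Finset.mul_sum, map_sum]
  refine Finset.sum_congr rfl fun l hl => ?_
  have hl : l ≤ n := Nat.lt_succ_iff.mp (Finset.mem_range.mp hl)
  have hc : ((n - l : ℕ) : ℝ) = n - l := Nat.cast_sub hl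
  have hln : (l : ℝ) ≤ n := by exact_mod_cast hl
  have hl0 : (0 : ℝ) ≤ l := l.cast_nonneg
  rw [mul_left_comm, jacobiFunctional_C_mul, jacobiFunctional_X_pow_moment,
    choose_eq_Gamma (by linarith), choose_eq_Gamma (by linarith), hc,
    show (n : ℝ) + B - (n - l) + 1 = B + l + 1 by ring,
    show a + b + ((n : ℝ) - l) + l + 2 = a + b + n + 2 by ring,
    show a + ((n : ℝ) - l) + 1 = a + n - l + 1 by ring]
  field_simp

/-! ### The connection coefficients -/

/-- Moving k derivatives onto P_n^{(α,γ)} leaves P_{n-k}^{(α+k,γ+k)} against ω_{a+k,b+k}. With q = 0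
the ₂F₁ is 1, and the sum over l agrees term by term with the ₃F₂. -/
theorem jacobiFunctional_jacobi_mul_jacobi_eq_connCoeff {α γ a b : ℝ} (hα : -1 < α) (hγ : -1 < γ)
    (ha : -1 < a) (hb : -1 < b) (n k : ℕ) (hk : k ≤ n) :
    jacobiFunctional ha hb (jacobi α γ n * jacobi a b k)
      = connCoeff α γ a b n k * jacobiNorm a b k := by
  obtain ⟨m, rfl⟩ := Nat.exists_eq_add_of_le' hk
  have hd := iterate_derivative_jacobi_add α γ m k
  have hX := jacobiFunctional_X_pow_mul_jacobi (neg_one_lt_add_natCast ha k)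
    (neg_one_lt_add_natCast hb k) (neg_one_lt_add_natCast hα k) (neg_one_lt_add_natCast hγ k) 0 m
  rw [pow_zero, one_mul] at hX
  rw [jacobiFunctional_mul_jacobi, hd, jacobiFunctional_C_mul, hX, connCoeff, jacobiNorm,
    Nat.add_sub_cancel, show (k : ℝ) - ((m + k : ℕ) : ℝ) = -(m : ℝ) by push_cast; ring,
    hyp32_neg_natCast, Finset.mul_sum, Finset.mul_sum, Finset.mul_sum, Finset.sum_mul]
  refine Finset.sum_congr rfl fun l hl => ?_
  have hl : l ≤ m := Nat.lt_succ_iff.mp (Finset.mem_range.mp hl)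
  have hlm : (l : ℝ) ≤ m := by exact_mod_cast hl
  have hl0 : (0 : ℝ) ≤ l := l.cast_nonneg
  have hk0 : (0 : ℝ) ≤ k := k.cast_nonneg
  -- Since l ≤ m, these Gamma arguments are positive, so the rising factorials of negative
  -- parameters are honest Gamma quotients with nonzero denominators.
  have p1 : 0 < m + k + α - l + 1 := by linarith
  have p2 : 0 < m + k + a - l + 1 := by linarith
  have p3 : 0 < b + k + 1 := by linarith
  have p4 : 0 < γ + k + 1 := by linarith
  have p5 : 0 < a + k + 1 := by linarith
  have p6 : 0 < m + k + a + 1 := by linarith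
  have p7 : 0 < γ + k + l + 1 := by linarith
  have p8 : 0 < a + b + m + 2 * k + 2 := by linarith
  have g1 := (Real.Gamma_pos_of_pos p1).ne'
  have g2 := (Real.Gamma_pos_of_pos p2).ne'
  have g3 := (Real.Gamma_pos_of_pos p3).ne'
  have g4 := (Real.Gamma_pos_of_pos p4).ne'
  have g5 := (Real.Gamma_pos_of_pos p5).ne'
  have g6 := (Real.Gamma_pos_of_pos p6).ne'
  have g7 := (Real.Gamma_pos_of_pos p7).ne'
  have g8 := (Real.Gamma_pos_of_pos p8).ne'
  have g9 := (gammaFactor_pos (t := a + b + 1) (by linarith) k).ne'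
  have hs : (-1 : ℝ) ^ m = (-1) ^ (m - l) * (-1) ^ l := by rw [← pow_add, Nat.sub_add_cancel hl]
  have hd2 : (m.descFactorial l : ℝ) = m.factorial / (m - l).factorial := by
    rw [eq_div_iff (by positivity), mul_comm]
    exact_mod_cast Nat.factorial_mul_descFactorial hl
  have hF : ∀ u v : ℝ, ordinaryHypergeometric (-(0 : ℝ)) u v (2 : ℝ) = 1 := fun u v => by
    simpa using ordinaryHypergeometric_neg_natCast 0 u v 2
  have hs2 : ((-1 : ℝ) ^ l) ^ 2 = 1 := by rw [← pow_mul, mul_comm, pow_mul]; norm_num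
  push_cast
  rw [hF, rising_neg_natCast, hs, hd2,
    show -α - ((m : ℝ) + k) = -(m + k + α) by ring, show -((m : ℝ) + k) - a = -(m + k + a) by ring,
    rising_neg_eq_Gamma p1, rising_neg_eq_Gamma p2, rising_eq_Gamma_div_of_pos p3,
    rising_eq_Gamma_div_of_pos p4,
    show a + k + (b + k) + 1 = a + b + 1 + k + k by ring,
    Real.rpow_add_natCast two_ne_zero, Real.rpow_add_natCast two_ne_zero,
    show (m : ℝ) + (α + k) + 1 = m + k + α + 1 by ring,
    show (m : ℝ) + (γ + k) + 1 = m + k + γ + 1 by ring,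
    show (m : ℝ) + (α + k) - l + 1 = m + k + α - l + 1 by ring,
    show a + (k : ℝ) + m - l + 1 = m + k + a - l + 1 by ring,
    show a + (k : ℝ) + (b + k) + m + 2 = a + b + m + 2 * k + 2 by ring,
    show (m : ℝ) + k + k + b + a + 2 = a + b + m + 2 * k + 2 by ring,
    show (k : ℝ) + γ + 1 = γ + k + 1 by ring,
    show (k : ℝ) + a + 1 = a + k + 1 by ring,
    show b + (k : ℝ) + 1 + l = b + k + l + 1 by ring,
    show γ + (k : ℝ) + 1 + l = γ + k + l + 1 by ring]
  simp only [one_div, inv_pow, one_pow, mul_one, add_zero]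
  field_simp
  rw [hs2]
  ring_nf

/-- The expansion of a Jacobi polynomial in Jacobi polynomials with other parameters. -/
theorem jacobi_eq_sum_connCoeff {α γ a b : ℝ} (hα : -1 < α) (hγ : -1 < γ) (ha : -1 < a)
    (hb : -1 < b) (n : ℕ) :
    jacobi α γ n = ∑ k ∈ Finset.range (n + 1), C (connCoeff α γ a b n k) * jacobi a b k :=
  eq_sum_jacobi_of_forall ha hb
    ((degree_le_of_natDegree_le (natDegree_jacobi_le α γ n)).trans_lt (by exact_mod_cast n.lt_succ_self))
    fun k hk => jacobiFunctional_jacobi_mul_jacobi_eq_connCoeff hα hγ ha hb n k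
      (Nat.lt_succ_iff.mp hk)

/-! ### The expansion coefficients of `x ^ s P_k` -/

/-- The Leibniz rule for the `i`-th derivative of `x ^ s P_k`. -/
theorem iterate_derivative_X_pow_mul_jacobi (a b : ℝ) (k s i : ℕ) :
    derivative^[i] (X ^ s * jacobi a b k) = ∑ r ∈ Finset.Icc (i - s) (min i k),
      C ((i.choose r : ℝ) * (s.factorial / (s + r - i).factorial)
          * ((1 / 2) ^ r * rising (k + a + b + 1) r))
        * (X ^ (s + r - i) * jacobi (a + r) (b + r) (k - r)) := by
  rw [iterate_derivative_mul]
  symm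
  -- In the full Leibniz sum, r > k annihilates P_k and i - r > s annihilates x^s.
  refine Finset.sum_subset_zero_on_sdiff ?_ ?_ ?_
  · intro r hr
    rw [Finset.mem_Icc] at hr
    rw [Finset.mem_range]
    omega
  · intro r hr
    rw [Finset.mem_sdiff, Finset.mem_range, Finset.mem_Icc] at hr
    rcases lt_or_ge k r with h | h
    · rw [iterate_derivative_jacobi_of_lt a b h, mul_zero, smul_zero]
    · rw [iterate_derivative_X_pow_eq_C_mul, Nat.descFactorial_of_lt (by omega)]
      simp
  · intro r hr
    rw [Finset.mem_Icc] at hr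
    have hd := iterate_derivative_jacobi_add a b (k - r) r
    have hf : (s.descFactorial (i - r) : ℝ) = s.factorial / (s + r - i).factorial := by
      rw [eq_div_iff (by positivity), mul_comm, show s + r - i = s - (i - r) by omega]
      exact_mod_cast Nat.factorial_mul_descFactorial (by omega : i - r ≤ s)
    rw [Nat.sub_add_cancel (by omega), Nat.cast_sub (by omega), sub_add_cancel] at hd
    rw [hd, iterate_derivative_X_pow_eq_C_mul, hf, nsmul_eq_mul,
      show s - (i - r) = s + r - i by omega]
    simp only [C_mul, ← C_eq_natCast]
    ring

-- The Leibniz rule supplies the sum over r, and the expansion of P_{k-r}^{(a+r,b+r)} against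
-- ω_{a+i,b+i} the sum over l; the two sides agree for each pair (r, l).
set_option maxHeartbeats 1000000 in
theorem jacobiFunctional_X_pow_mul_jacobi_mul_jacobi_eq_linCoeff {a b : ℝ} (ha : -1 < a)
    (hb : -1 < b) (k s i : ℕ) (hi : i ≤ k + s) :
    jacobiFunctional ha hb (X ^ s * jacobi a b k * jacobi a b i)
      = linCoeff a b k s i * jacobiNorm a b i := by
  rw [jacobiFunctional_mul_jacobi, iterate_derivative_X_pow_mul_jacobi, map_sum, Finset.mul_sum,
    linCoeff, Finset.mul_sum, Finset.sum_mul]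
  refine Finset.sum_congr rfl fun r hr => ?_
  rw [Finset.mem_Icc] at hr
  have hrk : r ≤ k := by omega
  rw [jacobiFunctional_C_mul, jacobiFunctional_X_pow_mul_jacobi (neg_one_lt_add_natCast ha i)
    (neg_one_lt_add_natCast hb i) (neg_one_lt_add_natCast ha r) (neg_one_lt_add_natCast hb r),
    Finset.mul_sum, Finset.mul_sum, Finset.mul_sum, Finset.mul_sum, Finset.sum_mul]
  refine Finset.sum_congr rfl fun l hl => ?_
  have hl : l ≤ k - r := Nat.lt_succ_iff.mp (Finset.mem_range.mp hl)
  have hs : (-1 : ℝ) ^ (k + s - i) = (-1) ^ (k - r - l + (s + r - i)) * (-1) ^ l := by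
    rw [← pow_add]
    congr 1
    omega
  have hs2 : ((-1 : ℝ) ^ l) ^ 2 = 1 := by rw [← pow_mul, mul_comm, pow_mul]; norm_num
  have hlk : (l : ℝ) + r ≤ k := by exact_mod_cast (by omega : l + r ≤ k)
  have hl0 : (0 : ℝ) ≤ l := l.cast_nonneg
  have hi0 : (0 : ℝ) ≤ i := i.cast_nonneg
  have hr0 : (0 : ℝ) ≤ r := r.cast_nonneg
  have p1 : 0 < a + i + 1 := by linarith
  have p2 : 0 < b + i + 1 := by linarith
  have p3 : 0 < k + a - l + 1 := by linarith
  have p4 : 0 < r + b + l + 1 := by linarith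
  have p5 : 0 < 2 * i + k - r + a + b + 2 := by linarith
  have g1 := (Real.Gamma_pos_of_pos p1).ne'
  have g2 := (Real.Gamma_pos_of_pos p2).ne'
  have g3 := (Real.Gamma_pos_of_pos p3).ne'
  have g4 := (Real.Gamma_pos_of_pos p4).ne'
  have g5 := (Real.Gamma_pos_of_pos p5).ne'
  have g6 := (gammaFactor_pos (t := a + b + 1) (by linarith) i).ne'
  rw [jacobiNorm, hs, Nat.cast_sub hrk, Nat.cast_sub (by omega : i ≤ s + r),
    show a + i + (b + i) + 1 = a + b + 1 + i + i by ring,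
    Real.rpow_add_natCast two_ne_zero, Real.rpow_add_natCast two_ne_zero,
    show (k : ℝ) - r + (a + r) + 1 = k + a + 1 by ring,
    show (k : ℝ) - r + (b + r) + 1 = k + b + 1 by ring,
    show (k : ℝ) - r + (a + r) - l + 1 = k + a - l + 1 by ring,
    show a + (i : ℝ) + (k - r) - l + 1 = i + k - r + a - l + 1 by ring,
    show b + (i : ℝ) + l + 1 = i + b + l + 1 by ring,
    show b + (r : ℝ) + l + 1 = r + b + l + 1 by ring,
    show a + (i : ℝ) + (b + i) + (k - r) + 2 = 2 * i + k - r + a + b + 2 by ring,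
    show -(((s + r : ℕ) : ℝ) - i) = i - s - r by push_cast; ring,
    show (i : ℝ) + a + 1 = a + i + 1 by ring, show (i : ℝ) + b + 1 = b + i + 1 by ring]
  -- With the arguments normalized, the transcendental values match as atoms and only a rational
  -- identity is left.
  generalize ordinaryHypergeometric ((i : ℝ) - s - r) (i + b + l + 1)
    (2 * i + k - r + a + b + 2) (2 : ℝ) = F
  generalize Real.Gamma (a + i + 1) = G1 at *
  generalize Real.Gamma (b + i + 1) = G2 at *
  generalize Real.Gamma (k + a - l + 1) = G3 at *
  generalize Real.Gamma (r + b + l + 1) = G4 at *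
  generalize Real.Gamma (2 * i + k - r + a + b + 2) = G5 at *
  generalize gammaFactor (a + b + 1) i = G6 at *
  generalize Real.Gamma (i + k - r + a - l + 1) = G7
  generalize Real.Gamma (i + b + l + 1) = G8
  generalize Real.Gamma (k + a + 1) = G9
  generalize Real.Gamma (k + b + 1) = G10
  generalize rising (k + a + b + 1) r = R
  generalize (2 : ℝ) ^ (a + b + 1) = T
  simp only [one_div, inv_pow]
  field_simp
  rw [hs2]
  ring

/-- The expansion of `x ^ s P_k` in Jacobi polynomials. -/
theorem X_pow_mul_jacobi_eq_sum_linCoeff {a b : ℝ} (ha : -1 < a) (hb : -1 < b) (k s : ℕ) :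
    X ^ s * jacobi a b k
      = ∑ i ∈ Finset.range (k + s + 1), C (linCoeff a b k s i) * jacobi a b i := by
  refine eq_sum_jacobi_of_forall ha hb ?_ fun i hi =>
    jacobiFunctional_X_pow_mul_jacobi_mul_jacobi_eq_linCoeff ha hb k s i (Nat.lt_succ_iff.mp hi)
  have h : (X ^ s * jacobi a b k).natDegree ≤ k + s := by
    rw [add_comm]
    exact natDegree_mul_le_of_le (natDegree_X_pow_le s) (natDegree_jacobi_le a b k)
  exact (degree_le_of_natDegree_le h).trans_lt (by exact_mod_cast (k + s).lt_succ_self)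

/-! ### The Krein-like functional -/

/-- The bases 1 ± x are nonnegative here, so the real powers multiply. P_n is placed next to x^s
because its expansion is the one that absorbs x^s. -/
theorem kreinIntegrand_eq {m n s : ℕ} {α γ β x : ℝ} (hx : x ∈ Set.Ioo (-1 : ℝ) 1) :
    kreinIntegrand m n s α γ β x
      = (X ^ s * jacobi α γ n * jacobi α γ m).eval x * jacobiWeight (α * β) (γ * β) x := by
  have h0 : 0 ≤ 1 + x := by linarith [hx.1]
  have h1 : 0 ≤ 1 - x := by linarith [hx.2]
  simp only [kreinIntegrand, jacobiWeight, eval_mul, eval_pow, eval_X]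
  rw [Real.mul_rpow (Real.rpow_nonneg h1 _) (Real.rpow_nonneg h0 _), ← Real.rpow_mul h1,
    ← Real.rpow_mul h0]
  ring

end KreinJacobi

open KreinJacobi in
theorem theorem6 (α γ β : ℝ) (hα : -1 < α) (hγ : -1 < γ)
    (hαβ : -1 < α * β) (hγβ : -1 < γ * β) :
    -- the integral exists and equals the triple sum
    (∀ m n s : ℕ,
      MeasureTheory.IntegrableOn (KreinJacobi.kreinIntegrand m n s α γ β) (Set.Ioo (-1 : ℝ) 1) ∧
      KreinJacobi.kreinFunctional m n s α γ β =
        ∑ k ∈ Finset.range (n + 1), ∑ j ∈ Finset.range (m + 1), ∑ i ∈ Finset.range (k + s + 1),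
          KreinJacobi.connCoeff α γ (α * β) (γ * β) n k
            * KreinJacobi.connCoeff α γ (α * β) (γ * β) m j
            * KreinJacobi.linCoeff (α * β) (γ * β) k s i
            * KreinJacobi.jacobiNorm (α * β) (γ * β) j
            * (if i = j then 1 else 0)) ∧
    -- the first family of coefficients consists of the connection coefficients
    (∀ n : ℕ,
      KreinJacobi.jacobi α γ n =
        ∑ k ∈ Finset.range (n + 1),
          Polynomial.C (KreinJacobi.connCoeff α γ (α * β) (γ * β) n k)
            * KreinJacobi.jacobi (α * β) (γ * β) k) ∧
    -- the second family of coefficients expands `x^s P_k`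
    (∀ k s : ℕ,
      Polynomial.X ^ s * KreinJacobi.jacobi (α * β) (γ * β) k =
        ∑ i ∈ Finset.range (k + s + 1),
          Polynomial.C (KreinJacobi.linCoeff (α * β) (γ * β) k s i)
            * KreinJacobi.jacobi (α * β) (γ * β) i) ∧
    -- the remaining factors are the Jacobi norms
    (∀ i j : ℕ,
      ∫ x in Set.Ioo (-1 : ℝ) 1,
          (KreinJacobi.jacobi (α * β) (γ * β) i).eval x
            * (KreinJacobi.jacobi (α * β) (γ * β) j).eval x
            * KreinJacobi.jacobiWeight (α * β) (γ * β) x =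
        KreinJacobi.jacobiNorm (α * β) (γ * β) j * (if i = j then 1 else 0)) := by
  refine ⟨fun m n s => ⟨?_, ?_⟩, jacobi_eq_sum_connCoeff hα hγ hαβ hγβ,
    X_pow_mul_jacobi_eq_sum_linCoeff hαβ hγβ, fun i j => ?_⟩
  · exact (integrableOn_eval_mul_jacobiWeight hαβ hγβ _).congr_fun
      (fun x hx => (kreinIntegrand_eq hx).symm) measurableSet_Ioo
  · rw [kreinFunctional, setIntegral_congr_fun measurableSet_Ioo fun x hx => kreinIntegrand_eq hx,
      ← jacobiFunctional_apply hαβ hγβ]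
    conv_lhs => rw [jacobi_eq_sum_connCoeff hα hγ hαβ hγβ n, jacobi_eq_sum_connCoeff hα hγ hαβ hγβ m]
    rw [Finset.mul_sum (Finset.range (n + 1)), Finset.sum_mul, map_sum]
    refine Finset.sum_congr rfl fun k _ => ?_
    rw [Finset.mul_sum, map_sum]
    refine Finset.sum_congr rfl fun j _ => ?_
    -- Expanding x^s P_k brings in the index i, and orthogonality then pairs it with the index j
    -- from P_m.
    rw [mul_left_comm, mul_left_comm (X ^ s), X_pow_mul_jacobi_eq_sum_linCoeff hαβ hγβ k s, Finset.mul_sum,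
      Finset.sum_mul, Finset.mul_sum, map_sum]
    refine Finset.sum_congr rfl fun i _ => ?_
    rw [show ∀ u v w z t : ℝ[X], u * (v * (w * z) * t) = u * (v * (w * (z * t))) by intros; ring,
      jacobiFunctional_C_mul, jacobiFunctional_C_mul, jacobiFunctional_C_mul,
      jacobiFunctional_jacobi_mul_jacobi]
    ring
  · rw [← jacobiFunctional_jacobi_mul_jacobi hαβ hγβ, jacobiFunctional_apply]
    simp only [eval_mul]
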